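/- Let $\mathcal H$ be a complex Hilbert space (scalar products are conjugate linear in the first argument) and let $q\in[-1,1]$. On $\mathcal H^{\otimes n}$ let $\langle F,G\rangle_n:=\langle F,\lambda_nG\rangle_{\otimes n}$, where $\lambda_n$ is the identity for $n\le 1$ and $\lambda_{n}:=\mathbf 1^{\otimes (n-2)}\otimes\lambda_2$ with $\lambda_2(f\otimes g):=f\otimes g+q\,g\otimes f$ for $n\ge 2$. Let $\mathcal H_n$ be the completion of the quotient of $(\mathcal H^{\otimes n},\langle\cdot,\cdot\rangle_n)$ by the kernel of $\langle\cdot,\cdot\rangle_n$ (so $\mathcal H_0=\mathbb C$), let $\Gamma_{q,2}(\mathcal H):=\bigoplus_{n\ge0}\mathcal H_n$ be the $(q,2)$-Fock space, with vacuum vector $\Phi:=1\oplus0\oplus0\oplus\cdots$, and for $f\in\mathcal H$ let $A^+(f)$ be the bounded creation operator given by $A^+(f)\Phi=f$ and $A^+(f)F=f\otimes F$ for $F\in\mathcal H_n$, $n\ge1$. Put $A(f):=(A^+(f))^*$, $A^{1}(f):=A^+(f)$ and $A^{-1}(f):=A(f)$. For $n\ge1$ let $\{-1,1\}^{2n}_+$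 be the set of all $\varepsilon:\{1,\dots,2n\}\to\{-1,1\}$ with $\sum_{h=1}^{2n}\varepsilon(h)=0$ and $\sum_{h=p}^{2n}\varepsilon(h)\ge0$ for all $p\in\{1,\dots,2n\}$. For $1\le k\le n$ let $\{-1,1\}^{2n}_{+,k}$ be the set of those $\varepsilon\in\{-1,1\}^{2n}_+$ for which $\max\varepsilon^{-1}(\{-1\})=2n-k$. For a unit vector $f\in\mathcal H$ set $$P_{n,k}:=\sum_{\varepsilon\in\{-1,1\}^{2n}_{+,k}}\big\langle\Phi,A^{\varepsilon(1)}(f)\cdots A^{\varepsilon(2n)}(f)\Phi\big\rangle,\qquad P_n:=\sum_{k=1}^nP_{n,k}.$$ Then, for every unit vector $f\in\mathcal H$: 1. $P_{n+1,1}=P_n$ and $P_{n+1,2}=(1+q)\,P_n$ for all $n\ge1$. 2. The numbers $P_{n,k}$ ($n\ge1$, $1\le k\le n$) do not depend on the choice of the unit vector $f$. 3. Let $n\ge1$, and for each $\varepsilon\in\{-1,1\}^{2n}_+$ let $\mathcal P_{n,\varepsilon}$ be a set of pair partitions $\{(l_h,r_h)\}_{h=1}^n$ of $\{1,\dots,2n\}$,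 with $l_h<r_h$, $\varepsilon(l_h)=-1$ and $\varepsilon(r_h)=1$ for all $h$. Suppose that for all $\varepsilon\in\{-1,1\}^{2n}_+$ and all $f_1,\dots,f_{2n}\in\mathcal H$ $$\big\langle\Phi,A^{\varepsilon(1)}(f_1)\cdots A^{\varepsilon(2n)}(f_{2n})\Phi\big\rangle=\sum_{\{(l_h,r_h)\}_{h=1}^n\in\mathcal P_{n,\varepsilon}}\ \prod_{h=1}^n\langle f_{l_h},f_{r_h}\rangle .$$ Then $P_{n,k}=\big|\bigcup_{\varepsilon\in\{-1,1\}^{2n}_{+,k}}\mathcal P_{n,\varepsilon}\big|$ for $1\le k\le n$, and $P_n=\big|\bigcup_{\varepsilon\in\{-1,1\}^{2n}_+}\mathcal P_{n,\varepsilon}\big|$. -/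

import Mathlib

open scoped TensorProduct ComplexConjugate InnerProductSpace

noncomputable section

namespace Q2Fock

variable {H : Type*} [NormedAddCommGroup H] [InnerProductSpace ℂ H]

/-! ### The tensor scalar product on the `n`-fold tensor power -/

/-- The linear functional `x ↦ ⟨v 0 ⊗ ⋯ ⊗ v (n-1), x⟩` on the `n`-fold tensor power. -/
def tensorFunctional {n : ℕ} (v : Fin n → H) : (⨂[ℂ]^n H) →ₗ[ℂ] ℂ :=
  PiTensorProduct.lift
    ((MultilinearMap.mkPiAlgebra ℂ (Fin n) ℂ).compLinearMap
      fun i => (innerₛₗ ℂ (v i) : H →ₗ[ℂ] ℂ))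

theorem tensorFunctional_tprod {n : ℕ} (v w : Fin n → H) :
    tensorFunctional v (PiTensorProduct.tprod ℂ w) = ∏ i, inner ℂ (v i) (w i) := by
  simp [tensorFunctional]

/-- The conjugate linear functional `x ↦ ⟨x, v 0 ⊗ ⋯ ⊗ v (n-1)⟩`. -/
def tensorAntiFunctional {n : ℕ} (v : Fin n → H) : (⨂[ℂ]^n H) →ₗ⋆[ℂ] ℂ where
  toFun x := conj (tensorFunctional v x)
  map_add' x y := by simp
  map_smul' c x := by simp

theorem tensorAntiFunctional_tprod {n : ℕ} (v w : Fin n → H) :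
    tensorAntiFunctional v (PiTensorProduct.tprod ℂ w) = ∏ i, inner ℂ (w i) (v i) := by
  simp [tensorAntiFunctional, tensorFunctional_tprod]

theorem antiFunctional_ext {n : ℕ} {φ ψ : (⨂[ℂ]^n H) →ₗ⋆[ℂ] ℂ}
    (h : ∀ w, φ (PiTensorProduct.tprod ℂ w) = ψ (PiTensorProduct.tprod ℂ w)) : φ = ψ := by
  ext x
  induction x using PiTensorProduct.induction_on with
  | smul_tprod r f => simp [h]
  | add x y hx hy => simp [hx, hy]

/-- `v ↦ (x ↦ ⟨x, v 0 ⊗ ⋯ ⊗ v (n-1)⟩)` as a multilinear map. -/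
def tensorAntiMultilinear (H : Type*) [NormedAddCommGroup H] [InnerProductSpace ℂ H] (n : ℕ) :
    MultilinearMap ℂ (fun _ : Fin n => H) ((⨂[ℂ]^n H) →ₗ⋆[ℂ] ℂ) where
  toFun := tensorAntiFunctional
  map_update_add' {d} v i x y := by
    obtain rfl := Subsingleton.elim d (instDecidableEqFin n)
    apply antiFunctional_ext
    intro w
    simp only [LinearMap.add_apply, tensorAntiFunctional_tprod,
      Fintype.prod_eq_mul_prod_compl i, Function.update_self, inner_add_right, add_mul]
    congr 1 <;> congr 1 <;> refine Finset.prod_congr rfl fun j hj => ?_ <;>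
    · have : j ≠ i := by simpa using hj
      simp [Function.update_of_ne this]
  map_update_smul' {d} v i c x := by
    obtain rfl := Subsingleton.elim d (instDecidableEqFin n)
    apply antiFunctional_ext
    intro w
    simp only [LinearMap.smul_apply, tensorAntiFunctional_tprod, smul_eq_mul,
      Fintype.prod_eq_mul_prod_compl i, Function.update_self, inner_smul_right, mul_assoc]
    congr 2
    refine Finset.prod_congr rfl fun j hj => ?_
    have : j ≠ i := by simpa using hj
    simp [Function.update_of_ne this]

/-- The usual tensor scalar product `⟨x, y⟩_⊗` on the `n`-fold tensor power of `H`: the sesquilinear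
form, conjugate linear in the first argument, which takes the value `∏ i, ⟨v i, w i⟩` at a pair of
elementary tensors. -/
def tensorInner {n : ℕ} (x y : ⨂[ℂ]^n H) : ℂ :=
  PiTensorProduct.lift (tensorAntiMultilinear H n) y x

theorem tensorInner_tprod {n : ℕ} (v w : Fin n → H) :
    tensorInner (PiTensorProduct.tprod ℂ v) (PiTensorProduct.tprod ℂ w)
      = ∏ i, inner ℂ (v i) (w i) := by
  simp [tensorInner, tensorAntiMultilinear, tensorAntiFunctional_tprod]

theorem tensorInner_add_left {n : ℕ} (x y z : ⨂[ℂ]^n H) :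
    tensorInner (x + y) z = tensorInner x z + tensorInner y z := by simp [tensorInner]

theorem tensorInner_add_right {n : ℕ} (x y z : ⨂[ℂ]^n H) :
    tensorInner x (y + z) = tensorInner x y + tensorInner x z := by simp [tensorInner]

theorem tensorInner_smul_left {n : ℕ} (c : ℂ) (x y : ⨂[ℂ]^n H) :
    tensorInner (c • x) y = conj c * tensorInner x y := by simp [tensorInner]

theorem tensorInner_smul_right {n : ℕ} (c : ℂ) (x y : ⨂[ℂ]^n H) :
    tensorInner x (c • y) = c * tensorInner x y := by simp [tensorInner]

theorem tensorInner_sum_left {n : ℕ} {ι : Type*} (s : Finset ι) (x : ι → ⨂[ℂ]^n H)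
    (y : ⨂[ℂ]^n H) : tensorInner (∑ i ∈ s, x i) y = ∑ i ∈ s, tensorInner (x i) y := by
  simp [tensorInner]

theorem tensorInner_sum_right {n : ℕ} {ι : Type*} (s : Finset ι) (x : ι → ⨂[ℂ]^n H)
    (y : ⨂[ℂ]^n H) : tensorInner y (∑ i ∈ s, x i) = ∑ i ∈ s, tensorInner y (x i) := by
  simp [tensorInner]

/-- Two-variable induction for identities which are additive in each variable. -/
theorem tensor_induction₂ {n : ℕ} {P : (⨂[ℂ]^n H) → (⨂[ℂ]^n H) → Prop}
    (h : ∀ (a b : ℂ) (v w : Fin n → H),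
      P (a • PiTensorProduct.tprod ℂ v) (b • PiTensorProduct.tprod ℂ w))
    (hl : ∀ x y z, P x z → P y z → P (x + y) z)
    (hr : ∀ x y z, P x y → P x z → P x (y + z)) (x y : ⨂[ℂ]^n H) : P x y := by
  induction x using PiTensorProduct.induction_on with
  | smul_tprod a v =>
    induction y using PiTensorProduct.induction_on with
    | smul_tprod b w => exact h a b v w
    | add y z hy hz => exact hr _ _ _ hy hz
  | add x x' hx hx' => exact hl _ _ _ hx hx'

theorem tensorInner_conj {n : ℕ} (x y : ⨂[ℂ]^n H) :
    conj (tensorInner y x) = tensorInner x y := by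
  refine tensor_induction₂ (P := fun x y => conj (tensorInner y x) = tensorInner x y)
    ?_ ?_ ?_ x y
  · intro a b v w
    simp only [tensorInner_smul_left, tensorInner_smul_right, tensorInner_tprod, map_mul, map_prod,
      inner_conj_symm, Complex.conj_conj]
    ring
  · intro x y z hx hy
    simp [tensorInner_add_left, tensorInner_add_right, hx, hy]
  · intro x y z hx hy
    simp [tensorInner_add_left, tensorInner_add_right, hx, hy]

theorem exists_sum_tprod {n : ℕ} (x : ⨂[ℂ]^n H) :
    ∃ (m : ℕ) (c : Fin m → ℂ) (v : Fin m → Fin n → H),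
      x = ∑ i, c i • PiTensorProduct.tprod ℂ (v i) := by
  induction x using PiTensorProduct.induction_on with
  | smul_tprod a v => exact ⟨1, fun _ => a, fun _ => v, by simp⟩
  | add x y hx hy =>
    obtain ⟨m, c, v, rfl⟩ := hx
    obtain ⟨m', c', v', rfl⟩ := hy
    exact ⟨m + m', Fin.append c c', Fin.append v v', by simp [Fin.sum_univ_add]⟩

open scoped ComplexOrder in
theorem posSemidef_prod_gram {n m : ℕ} (v : Fin m → Fin n → H) (s : Finset (Fin n)) :
    (Matrix.of fun i j : Fin m => ∏ k ∈ s, inner ℂ (v i k) (v j k)).PosSemidef := by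
  classical
  induction s using Finset.induction_on with
  | empty =>
    have h : (Matrix.of fun i j : Fin m => ∏ k ∈ (∅ : Finset (Fin n)), inner ℂ (v i k) (v j k))
        = Matrix.gram ℂ (fun _ : Fin m => (1 : ℂ)) := by
      ext i j
      simp [Matrix.gram]
    rw [h]
    exact Matrix.posSemidef_gram ℂ _
  | insert a s ha ih =>
    have h : (Matrix.of fun i j : Fin m => ∏ k ∈ insert a s, inner ℂ (v i k) (v j k))
        = (Matrix.gram ℂ (fun i : Fin m => v i a)).hadamard
          (Matrix.of fun i j : Fin m => ∏ k ∈ s, inner ℂ (v i k) (v j k)) := by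
      ext i j
      simp [Finset.prod_insert ha, Matrix.gram]
    rw [h]
    exact (Matrix.posSemidef_gram ℂ _).hadamard ih

open scoped ComplexOrder in
theorem tensorInner_self_nonneg {n : ℕ} (x : ⨂[ℂ]^n H) : 0 ≤ tensorInner x x := by
  obtain ⟨m, c, v, rfl⟩ := exists_sum_tprod x
  have h := (posSemidef_prod_gram v Finset.univ).dotProduct_mulVec_nonneg c
  convert h using 1
  simp only [tensorInner_sum_left, tensorInner_sum_right, tensorInner_smul_left,
    tensorInner_smul_right, tensorInner_tprod, dotProduct, Matrix.mulVec, Matrix.of_apply,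
    Pi.star_apply, Finset.mul_sum, RCLike.star_def]
  rw [Finset.sum_comm]
  refine Finset.sum_congr rfl fun i _ => Finset.sum_congr rfl fun j _ => ?_
  ring

/-! ### The operators `λ_n` and the `n`-particle spaces -/

/-- The linear operator on the `(n+2)`-fold tensor power exchanging the last two factors. -/
def flipLast (n : ℕ) : (⨂[ℂ]^(n + 2) H) →ₗ[ℂ] (⨂[ℂ]^(n + 2) H) :=
  (PiTensorProduct.reindex ℂ (fun _ : Fin (n + 2) => H)
    (Equiv.swap (Fin.last n).castSucc (Fin.last (n + 1)))).toLinearMap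

/-- The operators `λ_n`: the identity for `n ≤ 1`, and `𝟏^{⊗ (n-2)} ⊗ λ_2` for `n ≥ 2`, where
`λ_2 (f ⊗ g) = f ⊗ g + q g ⊗ f`. -/
def lam (q : ℝ) : (n : ℕ) → (⨂[ℂ]^n H) →ₗ[ℂ] (⨂[ℂ]^n H)
  | 0 => LinearMap.id
  | 1 => LinearMap.id
  | n + 2 => LinearMap.id + (q : ℂ) • flipLast n

theorem flipLast_tprod {n : ℕ} (v : Fin (n + 2) → H) :
    flipLast n (PiTensorProduct.tprod ℂ v) = PiTensorProduct.tprod ℂ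
      (fun i => v (Equiv.swap (Fin.last n).castSucc (Fin.last (n + 1)) i)) := by
  simp [flipLast]

theorem tensorInner_flipLast {n : ℕ} (x y : ⨂[ℂ]^(n + 2) H) :
    tensorInner (flipLast n x) y = tensorInner x (flipLast n y) := by
  refine tensor_induction₂
    (P := fun x y => tensorInner (flipLast n x) y = tensorInner x (flipLast n y)) ?_ ?_ ?_ x y
  · intro a b v w
    simp only [map_smul, tensorInner_smul_left, tensorInner_smul_right, flipLast_tprod,
      tensorInner_tprod]
    congr 2
    rw [← Equiv.prod_comp (Equiv.swap (Fin.last n).castSucc (Fin.last (n + 1)))]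
    simp
  · intro x y z hx hy
    simp [tensorInner_add_left, hx, hy]
  · intro x y z hx hy
    simp [tensorInner_add_right, hx, hy]

theorem flipLast_flipLast {n : ℕ} (x : ⨂[ℂ]^(n + 2) H) : flipLast n (flipLast n x) = x := by
  induction x using PiTensorProduct.induction_on with
  | smul_tprod a v =>
    simp only [map_smul, flipLast_tprod]
    congr 2
    funext i
    exact congrArg v (Equiv.swap_apply_self _ _ _)
  | add x y hx hy => simp [hx, hy]

theorem tensorInner_lam {n : ℕ} (q : ℝ) (x y : ⨂[ℂ]^n H) :
    tensorInner (lam q n x) y = tensorInner x (lam q n y) := by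
  match n, x, y with
  | 0, x, y => rfl
  | 1, x, y => rfl
  | n + 2, x, y =>
    simp only [lam, LinearMap.add_apply, LinearMap.id_apply, LinearMap.smul_apply,
      tensorInner_add_left, tensorInner_add_right, tensorInner_smul_left,
      tensorInner_smul_right, tensorInner_flipLast, Complex.conj_ofReal]

open scoped ComplexOrder in
/-- The exchange operator lies between `-1` and `1`. -/
theorem abs_re_flipLast_le {n : ℕ} (x : ⨂[ℂ]^(n + 2) H) :
    |(tensorInner x (flipLast n x)).re| ≤ (tensorInner x x).re := by
  have h1 := (Complex.nonneg_iff.1 (tensorInner_self_nonneg (x + flipLast n x))).1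
  have h2 := (Complex.nonneg_iff.1 (tensorInner_self_nonneg (x + (-1 : ℂ) • flipLast n x))).1
  simp only [tensorInner_add_left, tensorInner_add_right, tensorInner_flipLast, flipLast_flipLast,
    tensorInner_smul_left, tensorInner_smul_right, Complex.add_re] at h1 h2
  simp at h2
  rw [abs_le]
  constructor <;> linarith

open scoped ComplexOrder in
theorem lam_nonneg {n : ℕ} {q : ℝ} (hq : q ∈ Set.Icc (-1 : ℝ) 1) (x : ⨂[ℂ]^n H) :
    0 ≤ (tensorInner x (lam q n x)).re := by
  match n, x with
  | 0, x => exact (Complex.nonneg_iff.1 (tensorInner_self_nonneg x)).1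
  | 1, x => exact (Complex.nonneg_iff.1 (tensorInner_self_nonneg x)).1
  | n + 2, x =>
    have h := abs_le.1 (abs_re_flipLast_le x)
    have h0 := (Complex.nonneg_iff.1 (tensorInner_self_nonneg x)).1
    simp only [lam, LinearMap.add_apply, LinearMap.id_apply, LinearMap.smul_apply,
      tensorInner_add_right, tensorInner_smul_right, Complex.add_re, Complex.re_ofReal_mul]
    obtain ⟨hq1, hq2⟩ := hq
    nlinarith [h.1, h.2]

/-- The `n`-fold tensor power of `H`, to be equipped with the scalar product
`⟨F, G⟩_n = ⟨F, λ_n G⟩_⊗`. -/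
def PreParticle (_q : Set.Icc (-1 : ℝ) 1) (H : Type*) [NormedAddCommGroup H]
    [InnerProductSpace ℂ H] (n : ℕ) : Type _ := ⨂[ℂ]^n H

instance (q : Set.Icc (-1 : ℝ) 1) (n : ℕ) : AddCommGroup (PreParticle q H n) :=
  inferInstanceAs (AddCommGroup (⨂[ℂ]^n H))

instance (q : Set.Icc (-1 : ℝ) 1) (n : ℕ) : Module ℂ (PreParticle q H n) :=
  inferInstanceAs (Module ℂ (⨂[ℂ]^n H))

/-- The positive semidefinite scalar product `⟨F, G⟩_n = ⟨F, λ_n G⟩_⊗`. -/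
abbrev preParticleCore (q : Set.Icc (-1 : ℝ) 1) (H : Type*) [NormedAddCommGroup H]
    [InnerProductSpace ℂ H] (n : ℕ) : PreInnerProductSpace.Core ℂ (PreParticle q H n) where
  inner F G := tensorInner (n := n) (H := H) F (lam q n G)
  conj_inner_symm _ _ := (tensorInner_conj _ _).trans (tensorInner_lam _ _ _)
  re_inner_nonneg _ := lam_nonneg q.2 _
  add_left _ _ _ := tensorInner_add_left (H := H) (n := n) _ _ _
  smul_left _ _ _ := tensorInner_smul_left (H := H) (n := n) _ _ _

instance (q : Set.Icc (-1 : ℝ) 1) (n : ℕ) : SeminormedAddCommGroup (PreParticle q H n) :=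
  
  @InnerProductSpace.Core.toSeminormedAddCommGroup ℂ (PreParticle q H n) _ _ _
    (preParticleCore q H n)

instance (q : Set.Icc (-1 : ℝ) 1) (n : ℕ) : InnerProductSpace ℂ (PreParticle q H n) :=
  InnerProductSpace.ofCore (preParticleCore q H n)

theorem preParticle_inner (q : Set.Icc (-1 : ℝ) 1) {n : ℕ} (F G : PreParticle q H n) :
    inner ℂ F G = tensorInner (n := n) (H := H) F (lam q n G) := rfl

/-- The `n`-particle space: the completion of the quotient of the `n`-fold tensor power by the
kernel of `⟨·, λ_n ·⟩_⊗`. (The completion of a semi-inner-product space is Hausdorff, so it contains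
the passage to the quotient. For `n = 0` it is one-dimensional, spanned by the empty tensor.) -/
abbrev Particle (q : Set.Icc (-1 : ℝ) 1) (H : Type*) [NormedAddCommGroup H]
    [InnerProductSpace ℂ H] (n : ℕ) : Type _ := UniformSpace.Completion (PreParticle q H n)

/-- The `(q,2)`-Fock space over `H`: the Hilbert space direct sum of the `n`-particle spaces. -/
abbrev Fock (q : Set.Icc (-1 : ℝ) 1) (H : Type*) [NormedAddCommGroup H]
    [InnerProductSpace ℂ H] : Type _ := lp (fun n : ℕ => Particle q H n) 2

/-- The class in the `n`-particle space of an element of the `n`-fold tensor power. -/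
def toParticle (q : Set.Icc (-1 : ℝ) 1) {n : ℕ} (F : ⨂[ℂ]^n H) : Particle q H n :=
  ((show PreParticle q H n from F : PreParticle q H n) : Particle q H n)

/-- The vacuum vector `Φ = 1 ⊕ 0 ⊕ 0 ⊕ ⋯`. -/
def vacuum (q : Set.Icc (-1 : ℝ) 1) (H : Type*) [NormedAddCommGroup H]
    [InnerProductSpace ℂ H] : Fock q H :=
  lp.single 2 0 (toParticle q (PiTensorProduct.tprod ℂ (fun i : Fin 0 => i.elim0)))

/-! ### Creation and annihilation operators -/

/-- The map `F ↦ f ⊗ F` from the `n`-fold to the `(n+1)`-fold tensor power. -/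
def leftTensor (f : H) (n : ℕ) : (⨂[ℂ]^n H) →ₗ[ℂ] (⨂[ℂ]^(n + 1) H) :=
  PiTensorProduct.lift
    ((PiTensorProduct.tprod ℂ : MultilinearMap ℂ (fun _ : Fin (n + 1) => H) _).curryLeft f)

theorem leftTensor_tprod (f : H) {n : ℕ} (v : Fin n → H) :
    leftTensor f n (PiTensorProduct.tprod ℂ v)
      = PiTensorProduct.tprod ℂ (Fin.cons f v : Fin (n + 1) → H) := by
  simp [leftTensor]

theorem tensorInner_leftTensor (f : H) {n : ℕ} (x y : ⨂[ℂ]^n H) :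
    tensorInner (leftTensor f n x) (leftTensor f n y) = (‖f‖ : ℂ) ^ 2 * tensorInner x y := by
  refine tensor_induction₂ (P := fun x y => tensorInner (leftTensor f n x) (leftTensor f n y)
    = (‖f‖ : ℂ) ^ 2 * tensorInner x y) ?_ ?_ ?_ x y
  · intro a b v w
    simp only [map_smul, tensorInner_smul_left, tensorInner_smul_right, leftTensor_tprod,
      tensorInner_tprod, Fin.prod_univ_succ, Fin.cons_zero, Fin.cons_succ,
      inner_self_eq_norm_sq_to_K]
    simp only [Complex.coe_algebraMap]
    ring
  · intro x y z hx hy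
    simp [tensorInner_add_left, hx, hy, mul_add]
  · intro x y z hx hy
    simp [tensorInner_add_right, hx, hy, mul_add]

theorem flipLast_leftTensor (f : H) {n : ℕ} (x : ⨂[ℂ]^(n + 2) H) :
    flipLast (n + 1) (leftTensor f (n + 2) x) = leftTensor f (n + 2) (flipLast n x) := by
  induction x using PiTensorProduct.induction_on with
  | smul_tprod a v =>
    simp only [map_smul, leftTensor_tprod, flipLast_tprod]
    congr 2
    funext i
    refine Fin.cases ?_ (fun j => ?_) i
    · rw [Equiv.swap_apply_of_ne_of_ne]
      · simp
      · simp [Fin.ext_iff]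
      · simp [Fin.ext_iff]
    · rw [Fin.cons_succ]
      have h1 : (Fin.last (n + 1)).castSucc = (Fin.last n).castSucc.succ := by ext; simp
      have h2 : Fin.last (n + 1 + 1) = (Fin.last (n + 1)).succ := by ext; simp
      rw [h1, h2, ← Function.Injective.map_swap (Fin.succ_injective _), Fin.cons_succ]
  | add x y hx hy => simp [hx, hy]

theorem leftTensor_bound (q : Set.Icc (-1 : ℝ) 1) (f : H) {n : ℕ} (x : ⨂[ℂ]^n H) :
    (tensorInner (leftTensor f n x) (lam q (n + 1) (leftTensor f n x))).re
      ≤ 2 * ‖f‖ ^ 2 * (tensorInner x (lam q n x)).re := by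
  have key : ∀ {m : ℕ} (a b : ⨂[ℂ]^m H),
      (tensorInner (leftTensor f m a) (leftTensor f m b)).re = ‖f‖ ^ 2 * (tensorInner a b).re := by
    intro m a b
    rw [tensorInner_leftTensor, ← Complex.ofReal_pow, Complex.re_ofReal_mul]
  have hf : 0 ≤ ‖f‖ ^ 2 := by positivity
  match n, x with
  | 0, x =>
    have h := mul_nonneg hf (lam_nonneg (n := 0) q.2 x)
    simp only [lam, LinearMap.id_apply, key] at h ⊢
    linarith
  | 1, x =>
    have h := abs_le.1 (abs_re_flipLast_le (n := 0) (leftTensor f 1 x))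
    have h0 := mul_nonneg hf (lam_nonneg (n := 1) q.2 x)
    rw [key] at h
    simp only [lam, LinearMap.add_apply, LinearMap.id_apply, LinearMap.smul_apply,
      tensorInner_add_right, tensorInner_smul_right, Complex.add_re, Complex.re_ofReal_mul,
      key] at h0 ⊢
    obtain ⟨hq1, hq2⟩ := q.2
    nlinarith [h.1, h.2]
  | n + 2, x =>
    have h0 := mul_nonneg hf (lam_nonneg (n := n + 2) q.2 x)
    have : lam q (n + 2 + 1) (leftTensor f (n + 2) x)
        = leftTensor f (n + 2) (lam q (n + 2) x) := by
      simp [lam, flipLast_leftTensor]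
    rw [this, key]
    linarith

/-- The map `F ↦ f ⊗ F`, as a bounded operator for the norms of `⟨·, ·⟩_n` and `⟨·, ·⟩_{n+1}`. -/
def preCreation (q : Set.Icc (-1 : ℝ) 1) (f : H) (n : ℕ) :
    PreParticle q H n →L[ℂ] PreParticle q H (n + 1) :=
  LinearMap.mkContinuous
    ({ toFun := fun F => leftTensor f n F
       map_add' := fun F G => (leftTensor f n).map_add F G
       map_smul' := fun c F => (leftTensor f n).map_smul c F } :
      PreParticle q H n →ₗ[ℂ] PreParticle q H (n + 1))
    (√2 * ‖f‖) (fun F => by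
      refine le_of_sq_le_sq ?_ (by positivity)
      rw [mul_pow, mul_pow, Real.sq_sqrt (by norm_num), @norm_sq_eq_re_inner ℂ,
        @norm_sq_eq_re_inner ℂ (PreParticle q H n)]
      exact leftTensor_bound q f F)

/-- The map `F ↦ f ⊗ F` from the `n`-particle space to the `(n+1)`-particle space. -/
def particleCreation (q : Set.Icc (-1 : ℝ) 1) (f : H) (n : ℕ) :
    Particle q H n →L[ℂ] Particle q H (n + 1) :=
  (UniformSpace.Completion.toComplL.comp (preCreation q f n)).extend
    (UniformSpace.Completion.toComplL : PreParticle q H n →L[ℂ] Particle q H n)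

theorem particleCreation_coe (q : Set.Icc (-1 : ℝ) 1) (f : H) (n : ℕ) (F : PreParticle q H n) :
    particleCreation q f n (F : Particle q H n) = (preCreation q f n F : Particle q H (n + 1)) := by
  have h := ContinuousLinearMap.extend_eq
    (UniformSpace.Completion.toComplL.comp (preCreation q f n))
    (e := (UniformSpace.Completion.toComplL : PreParticle q H n →L[ℂ] Particle q H n))
    UniformSpace.Completion.denseRange_coe
    (UniformSpace.Completion.isUniformInducing_coe _) F
  exact h

/-- On classes of tensors, `particleCreation` is `F ↦ f ⊗ F`. -/
theorem particleCreation_toParticle (q : Set.Icc (-1 : ℝ) 1) (f : H) {n : ℕ} (F : ⨂[ℂ]^n H) :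
    particleCreation q f n (toParticle q F) = toParticle q (leftTensor f n F) :=
  particleCreation_coe q f n _

theorem norm_particleCreation_le (q : Set.Icc (-1 : ℝ) 1) (f : H) (n : ℕ) (F : Particle q H n) :
    ‖particleCreation q f n F‖ ≤ √2 * ‖f‖ * ‖F‖ := by
  induction F using UniformSpace.Completion.induction_on with
  | hp => exact isClosed_le (by fun_prop) (by fun_prop)
  | ih F =>
    rw [particleCreation_coe, UniformSpace.Completion.norm_coe, UniformSpace.Completion.norm_coe]
    exact (preCreation q f n).le_of_opNorm_le (LinearMap.mkContinuous_norm_le _ (by positivity) _) F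

/-- The components of `A⁺(f) F`: the `0`-particle component vanishes, and the `(n+1)`-particle
component is `f ⊗ F_n`. -/
def creationFun (q : Set.Icc (-1 : ℝ) 1) (f : H) (F : ∀ n, Particle q H n) : ∀ n, Particle q H n
  | 0 => 0
  | n + 1 => particleCreation q f n (F n)

theorem creationFun_hasSum (q : Set.Icc (-1 : ℝ) 1) (f : H) (F : Fock q H) :
    Summable (fun n => ‖creationFun q f F n‖ ^ (2 : ENNReal).toReal) ∧
      ∑' n, ‖creationFun q f F n‖ ^ (2 : ENNReal).toReal
        ≤ (√2 * ‖f‖ * ‖F‖) ^ (2 : ENNReal).toReal := by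
  have hF := (lp.hasSum_norm (p := 2) (by norm_num) F).mul_left
    ((√2 * ‖f‖) ^ (2 : ENNReal).toReal)
  have hle : ∀ n, ‖creationFun q f F (n + 1)‖ ^ (2 : ENNReal).toReal
      ≤ (√2 * ‖f‖) ^ (2 : ENNReal).toReal * ‖F n‖ ^ (2 : ENNReal).toReal := by
    intro n
    rw [← Real.mul_rpow (by positivity) (by positivity)]
    exact Real.rpow_le_rpow (by positivity) (norm_particleCreation_le q f n (F n)) (by norm_num)
  have hs : Summable (fun n => ‖creationFun q f F (n + 1)‖ ^ (2 : ENNReal).toReal) :=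
    Summable.of_nonneg_of_le (fun n => by positivity) hle hF.summable
  have hs' := (summable_nat_add_iff
    (f := fun n => ‖creationFun q f F n‖ ^ (2 : ENNReal).toReal) 1).1 hs
  refine ⟨hs', ?_⟩
  rw [hs'.tsum_eq_zero_add, Real.mul_rpow (by positivity) (by positivity), ← hF.tsum_eq]
  have h0 : ‖creationFun q f F 0‖ ^ (2 : ENNReal).toReal = 0 := by simp [creationFun]
  rw [h0, zero_add]
  exact hs.tsum_le_tsum hle hF.summable

/-- The creation operator `A⁺(f)`: the bounded linear operator on the `(q,2)`-Fock space with
`A⁺(f) Φ = f` and `A⁺(f) F = f ⊗ F` for `F` in an `n`-particle space. -/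
def creation (q : Set.Icc (-1 : ℝ) 1) (f : H) : Fock q H →L[ℂ] Fock q H :=
  LinearMap.mkContinuous
    { toFun := fun F => ⟨creationFun q f F, memℓp_gen (creationFun_hasSum q f F).1⟩
      map_add' := fun F G => by
        ext n
        cases n with
        | zero => exact (add_zero (0 : Particle q H 0)).symm
        | succ n => exact (particleCreation q f n).map_add (F n) (G n)
      map_smul' := fun c F => by
        ext n
        cases n with
        | zero => exact (smul_zero c : c • (0 : Particle q H 0) = 0).symm
        | succ n => exact (particleCreation q f n).map_smul c (F n) }
    (√2 * ‖f‖) (fun F => lp.norm_le_of_tsum_le (p := 2) (by norm_num) (by positivity)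
      (creationFun_hasSum q f F).2)

/-- The annihilation operator `A(f) = A⁺(f)^*`. -/
def annihilation (q : Set.Icc (-1 : ℝ) 1) (f : H) : Fock q H →L[ℂ] Fock q H :=
  ContinuousLinearMap.adjoint (creation q f)

/-- `A^ε(f)`, which is `A⁺(f)` for `ε = 1` and `A(f)` for `ε = -1`. -/
def signedOp (q : Set.Icc (-1 : ℝ) 1) (e : ℤˣ) (f : H) : Fock q H →L[ℂ] Fock q H :=
  if e = 1 then creation q f else annihilation q f

/-- The mixed moment `⟨Φ, A^{ε(1)}(f_1) ⋯ A^{ε(m)}(f_m) Φ⟩`. -/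
def mixedMoment (q : Set.Icc (-1 : ℝ) 1) {m : ℕ} (ε : Fin m → ℤˣ) (f : Fin m → H) : ℂ :=
  inner ℂ (vacuum q H) ((List.ofFn fun i => signedOp q (ε i) (f i)).prod (vacuum q H))

/-! ### Sign sequences and the numbers `P_{n,k}`

The positions `1, …, 2n` are represented by `Fin (2 * n)`, position `h` being the index `h - 1`. -/

/-- `{-1,1}^{2n}_+`: the sign sequences of length `2n` with total sum `0` all of whose tail sums
are nonnegative. -/
def signSeq (n : ℕ) : Finset (Fin (2 * n) → ℤˣ) :=
  {ε | ∑ h, (ε h : ℤ) = 0 ∧ ∀ p, 0 ≤ ∑ h ∈ Finset.Ici p, (ε h : ℤ)}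

/-- `{-1,1}^{2n}_{+,k}`: the sequences in `{-1,1}^{2n}_+` whose last `-1` is at position
`2n - k`. -/
def signSeqLast (n k : ℕ) : Finset (Fin (2 * n) → ℤˣ) :=
  {ε ∈ signSeq n | ∃ j : Fin (2 * n), (j : ℕ) + 1 + k = 2 * n ∧ ε j = -1 ∧ ∀ i, j < i → ε i = 1}

/-- `P_{n,k} = ∑_{ε ∈ {-1,1}^{2n}_{+,k}} ⟨Φ, A^{ε(1)}(f) ⋯ A^{ε(2n)}(f) Φ⟩`, for a unit
vector `f`. -/
def pairCount (q : Set.Icc (-1 : ℝ) 1) (f : H) (n k : ℕ) : ℂ :=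
  ∑ ε ∈ signSeqLast n k, mixedMoment q ε (fun _ => f)

/-- `P_n = ∑_{k=1}^n P_{n,k}`. -/
def totalCount (q : Set.Icc (-1 : ℝ) 1) (f : H) (n : ℕ) : ℂ :=
  ∑ k ∈ Finset.Icc 1 n, pairCount q f n k

/-! ### Pair partitions -/

/-- `θ` is a pair partition of the `2n` positions, written as a set of pairs `(l, r)`, `l < r`. -/
def IsPairPartition (n : ℕ) (θ : Finset (Fin (2 * n) × Fin (2 * n))) : Prop :=
  θ.card = n ∧ (∀ p ∈ θ, p.1 < p.2) ∧ ∀ i, ∃ p ∈ θ, i = p.1 ∨ i = p.2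

/-- `PP(2n, ε)`: the pair partitions whose left indices carry the sign `-1` and whose right
indices carry the sign `1`. -/
def IsPairPartitionOf {n : ℕ} (ε : Fin (2 * n) → ℤˣ)
    (θ : Finset (Fin (2 * n) × Fin (2 * n))) : Prop :=
  IsPairPartition n θ ∧ ∀ p ∈ θ, ε p.1 = -1 ∧ ε p.2 = 1

/-- The sets `S ε ⊆ PP(2n, ε)`, for `ε ∈ {-1,1}^{2n}_+`, compute the mixed moments on the
`(q,2)`-Fock space over `H`:
`⟨Φ, A^{ε(1)}(f_1) ⋯ A^{ε(2n)}(f_{2n}) Φ⟩ = ∑_{θ ∈ S ε} ∏_{(l,r) ∈ θ} ⟨f_l, f_r⟩`. -/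
def RepresentsMoments (q : Set.Icc (-1 : ℝ) 1) (H : Type*) [NormedAddCommGroup H]
    [InnerProductSpace ℂ H] {n : ℕ}
    (S : (Fin (2 * n) → ℤˣ) → Finset (Finset (Fin (2 * n) × Fin (2 * n)))) : Prop :=
  ∀ ε ∈ signSeq n, (∀ θ ∈ S ε, IsPairPartitionOf ε θ) ∧
    ∀ f : Fin (2 * n) → H,
      mixedMoment q ε f = ∑ θ ∈ S ε, ∏ p ∈ θ, inner ℂ (f p.1) (f p.2)

end Q2Fock

end

/-! With a single unit vector `f`, all words in `A⁺(f)` and `A(f)` act on the vectors `f^{⊗n}`,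
where `A⁺(f)` raises the exponent and `A(f)` lowers it with factor `1 + q` from `f^{⊗2}` to `f`,
factor `1` from any other positive exponent, and kills the vacuum (`annihilation_powerVector_succ`,
`annihilation_powerVector_zero`). Every moment is therefore a number depending on `q` and the signs
only, which gives independence of `f`.

The rightmost letters act first. A sequence whose last `-1` is followed by one `1` starts with `A A⁺
Φ = Φ`, so deleting this block preserves the moment. If exactly two `1`s follow, it starts with `A
A⁺ A⁺ Φ = (1 + q) A⁺ Φ`, so the block can be replaced by a single `1` at the cost of `1 + q`. Both
operations are bijections onto the balanced sequences shorter by two, and these are exhausted by the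
disjoint classes `k = 1, …, n` (`signSeq_eq_biUnion`).

For the cardinalities, putting all `f_i = f` turns each product of scalar products into `1`, so a
moment counts the pair partitions of its sign sequence; a pair partition determines that sequence,
so no partition is counted twice. -/

namespace Q2Fock

/-! ### Action of creation and annihilation on the powers of one vector -/

section PowerVectors

variable {H : Type*} [NormedAddCommGroup H] [InnerProductSpace ℂ H]

/-- The factor `c` in `A(f) f^{⊗(n+1)} = c f^{⊗n}`, for a unit vector `f`. -/
def loweringFactor (q : ℝ) (n : ℕ) : ℂ := if n = 1 then 1 + (q : ℂ) else 1

/-- The vector `f^{⊗n}` of the `(q,2)`-Fock space. -/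
noncomputable def powerVector (q : Set.Icc (-1 : ℝ) 1) (f : H) (n : ℕ) : Fock q H :=
  lp.single 2 n (toParticle q (PiTensorProduct.tprod ℂ (fun _ : Fin n => f)))

theorem powerVector_zero (q : Set.Icc (-1 : ℝ) 1) (f : H) : powerVector q f 0 = vacuum q H := by
  unfold powerVector vacuum
  congr 3
  exact Subsingleton.elim _ _

theorem leftTensor_tprod_const (f : H) (n : ℕ) :
    leftTensor f n (PiTensorProduct.tprod ℂ (fun _ : Fin n => f))
      = PiTensorProduct.tprod ℂ (fun _ : Fin (n + 1) => f) := by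
  rw [leftTensor_tprod]
  congr 1
  funext i
  refine Fin.cases ?_ (fun j => ?_) i <;> simp

theorem lam_tprod_const (q : ℝ) (f : H) (n : ℕ) :
    lam q (n + 2) (PiTensorProduct.tprod ℂ (fun _ : Fin (n + 2) => f))
      = (1 + (q : ℂ)) • PiTensorProduct.tprod ℂ (fun _ : Fin (n + 2) => f) := by
  simp [lam, flipLast_tprod, add_smul]

/-- On a power of `f`, `λ_m` is the scalar `1 + q` for `m ≥ 2` and `1` for `m ≤ 1`. Passing from `n`
to `n + 1` changes this scalar only at `n = 1`. For `n ≥ 2` the same `1 + q` stands on both sides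
and nothing is divided by it, so `q = -1` is allowed. -/
theorem inner_leftTensor_tprod_const (q : ℝ) {f : H} (hf : ‖f‖ = 1) (n : ℕ) (x : ⨂[ℂ]^n H) :
    tensorInner (leftTensor f n x)
        (lam q (n + 1) (PiTensorProduct.tprod ℂ (fun _ : Fin (n + 1) => f)))
      = loweringFactor q n *
        tensorInner x (lam q n (PiTensorProduct.tprod ℂ (fun _ : Fin n => f))) := by
  have key : ∀ m (y : ⨂[ℂ]^m H), tensorInner (leftTensor f m y)
      (PiTensorProduct.tprod ℂ (fun _ : Fin (m + 1) => f))
        = tensorInner y (PiTensorProduct.tprod ℂ (fun _ : Fin m => f)) := by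
    intro m y
    rw [← leftTensor_tprod_const, tensorInner_leftTensor, hf]
    simp
  match n, x with
  | 0, x => simp [lam, loweringFactor, key]
  | 1, x =>
    rw [lam_tprod_const, tensorInner_smul_right, key]
    simp [lam, loweringFactor]
  | n + 2, x =>
    rw [lam_tprod_const, lam_tprod_const, tensorInner_smul_right, tensorInner_smul_right, key]
    simp [loweringFactor]

/-- Both sides are continuous in `F`, so the identity for tensors extends to the completion. -/
theorem inner_particleCreation (q : Set.Icc (-1 : ℝ) 1) {f : H} (hf : ‖f‖ = 1) (n : ℕ)
    (F : Particle q H n) :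
    inner ℂ (particleCreation q f n F)
        (toParticle q (PiTensorProduct.tprod ℂ (fun _ : Fin (n + 1) => f)))
      = loweringFactor q n *
        inner ℂ F (toParticle q (PiTensorProduct.tprod ℂ (fun _ : Fin n => f))) := by
  induction F using UniformSpace.Completion.induction_on with
  | hp => exact isClosed_eq (by fun_prop) (by fun_prop)
  | ih F =>
    rw [particleCreation_coe]
    unfold toParticle
    rw [UniformSpace.Completion.inner_coe, UniformSpace.Completion.inner_coe]
    exact inner_leftTensor_tprod_const q hf n F

theorem creation_powerVector (q : Set.Icc (-1 : ℝ) 1) (f : H) (n : ℕ) :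
    creation q f (powerVector q f n) = powerVector q f (n + 1) := by
  ext m
  cases m with
  | zero =>
    rw [powerVector, powerVector, lp.single_apply_ne _ _ _ (by simp)]
    rfl
  | succ m =>
    change particleCreation q f m (powerVector q f n m) = _
    by_cases h : m = n
    · subst h
      rw [powerVector, powerVector, lp.single_apply_self, lp.single_apply_self,
        particleCreation_toParticle, leftTensor_tprod_const]
    · rw [powerVector, powerVector, lp.single_apply_ne _ _ _ h,
        lp.single_apply_ne _ _ _ (by simpa using h), map_zero]

theorem annihilation_powerVector_zero (q : Set.Icc (-1 : ℝ) 1) (f : H) :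
    annihilation q f (powerVector q f 0) = 0 := by
  refine ext_inner_left ℂ fun F => ?_
  rw [annihilation, ContinuousLinearMap.adjoint_inner_right, powerVector, lp.inner_single_right,
    inner_zero_right]
  -- The vacuum component of `A⁺(f) F` is zero by definition.
  exact inner_zero_left _

theorem annihilation_powerVector_succ (q : Set.Icc (-1 : ℝ) 1) {f : H} (hf : ‖f‖ = 1) (n : ℕ) :
    annihilation q f (powerVector q f (n + 1)) = loweringFactor q n • powerVector q f n := by
  refine ext_inner_left ℂ fun F => ?_
  rw [annihilation, ContinuousLinearMap.adjoint_inner_right, inner_smul_right, powerVector,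
    powerVector, lp.inner_single_right, lp.inner_single_right]
  exact inner_particleCreation q hf n (F n)

theorem inner_vacuum_powerVector (q : Set.Icc (-1 : ℝ) 1) (f : H) (n : ℕ) :
    inner ℂ (vacuum q H) (powerVector q f n) = if n = 0 then 1 else 0 := by
  cases n with
  | zero =>
    rw [if_pos rfl, powerVector_zero, vacuum, lp.inner_single_right, lp.single_apply_self]
    unfold toParticle
    rw [UniformSpace.Completion.inner_coe]
    exact (tensorInner_tprod _ _).trans (by simp)
  | succ n =>
    rw [if_neg (by simp), vacuum, lp.inner_single_left, powerVector,
      lp.single_apply_ne _ _ _ (by simp), inner_zero_right]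

/-- The word `A^{ε(1)}(f) ⋯ A^{ε(m)}(f)`. -/
noncomputable def signWord (q : Set.Icc (-1 : ℝ) 1) (f : H) {m : ℕ} (ε : Fin m → ℤˣ) :
    Fock q H →L[ℂ] Fock q H :=
  (List.ofFn fun i => signedOp q (ε i) f).prod

theorem mixedMoment_const (q : Set.Icc (-1 : ℝ) 1) (f : H) {m : ℕ} (ε : Fin m → ℤˣ) :
    mixedMoment q ε (fun _ => f) = inner ℂ (vacuum q H) (signWord q f ε (powerVector q f 0)) := by
  rw [powerVector_zero]
  rfl

/-- The last sign belongs to the operator applied first; hence words are analysed by `Fin.snoc`. -/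
theorem signWord_snoc (q : Set.Icc (-1 : ℝ) 1) (f : H) {m : ℕ} (ε : Fin m → ℤˣ) (e : ℤˣ)
    (F : Fock q H) :
    signWord q f (Fin.snoc ε e : Fin (m + 1) → ℤˣ) F = signWord q f ε (signedOp q e f F) := by
  rw [signWord, List.ofFn_succ']
  simp [signWord, List.concat_eq_append]

theorem signedOp_one_powerVector (q : Set.Icc (-1 : ℝ) 1) (f : H) (n : ℕ) :
    signedOp q 1 f (powerVector q f n) = powerVector q f (n + 1) := by
  rw [signedOp, if_pos rfl, creation_powerVector]

theorem signedOp_neg_one_powerVector_succ (q : Set.Icc (-1 : ℝ) 1) {f : H} (hf : ‖f‖ = 1)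
    (n : ℕ) :
    signedOp q (-1) f (powerVector q f (n + 1)) = loweringFactor q n • powerVector q f n := by
  rw [signedOp, if_neg (by decide), annihilation_powerVector_succ q hf]

/-- The vectors `f^{⊗n}` are mapped to multiples of such vectors by words in `A⁺(f)`, `A(f)`, with
a multiple and an exponent which do not depend on the unit vector `f`. -/
theorem exists_signWord_powerVector (q : Set.Icc (-1 : ℝ) 1) (H : Type*) [NormedAddCommGroup H]
    [InnerProductSpace ℂ H] {m : ℕ} (ε : Fin m → ℤˣ) (n : ℕ) :
    ∃ (c : ℂ) (d : ℕ), ∀ f : H, ‖f‖ = 1 →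
      signWord q f ε (powerVector q f n) = c • powerVector q f d := by
  induction m generalizing n with
  | zero => exact ⟨1, n, fun f _ => by simp [signWord]⟩
  | succ m ih =>
    rw [← Fin.snoc_init_self ε]
    rcases Int.units_eq_one_or (ε (Fin.last m)) with h | h
    · obtain ⟨c, d, hcd⟩ := ih (Fin.init ε) (n + 1)
      exact ⟨c, d, fun f hf => by rw [signWord_snoc, h, signedOp_one_powerVector, hcd f hf]⟩
    · cases n with
      | zero =>
        -- Annihilating the vacuum gives zero; the exponent is a dummy value.
        refine ⟨0, 0, fun f hf => ?_⟩
        rw [signWord_snoc, h, signedOp, if_neg (by decide), annihilation_powerVector_zero,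
          map_zero, zero_smul]
      | succ n =>
        obtain ⟨c, d, hcd⟩ := ih (Fin.init ε) n
        refine ⟨loweringFactor q n * c, d, fun f hf => ?_⟩
        rw [signWord_snoc, h, signedOp_neg_one_powerVector_succ q hf, map_smul, hcd f hf, smul_smul]

theorem mixedMoment_const_eq (q : Set.Icc (-1 : ℝ) 1) {f g : H} (hf : ‖f‖ = 1) (hg : ‖g‖ = 1)
    {m : ℕ} (ε : Fin m → ℤˣ) :
    mixedMoment q ε (fun _ => g) = mixedMoment q ε (fun _ => f) := by
  obtain ⟨c, d, h⟩ := exists_signWord_powerVector q H ε 0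
  simp only [mixedMoment_const, h f hf, h g hg, inner_smul_right, inner_vacuum_powerVector]

/-- `A(f) A⁺(f) Φ = Φ`, the lowering factor at `0` being `1`. -/
theorem mixedMoment_snoc_neg_one_one (q : Set.Icc (-1 : ℝ) 1) {f : H} (hf : ‖f‖ = 1) {m : ℕ}
    (ε : Fin m → ℤˣ) :
    mixedMoment q (Fin.snoc (Fin.snoc ε (-1) : Fin (m + 1) → ℤˣ) 1 : Fin (m + 2) → ℤˣ)
      (fun _ => f) = mixedMoment q ε (fun _ => f) := by
  simp only [mixedMoment_const, signWord_snoc, signedOp_one_powerVector,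
    signedOp_neg_one_powerVector_succ q hf]
  simp [loweringFactor]

/-- `A(f) A⁺(f) A⁺(f) Φ = (1 + q) f = (1 + q) A⁺(f) Φ`: the lowering factor at `1` is the only
source of `q`. -/
theorem mixedMoment_snoc_neg_one_one_one (q : Set.Icc (-1 : ℝ) 1) {f : H} (hf : ‖f‖ = 1) {m : ℕ}
    (ε : Fin m → ℤˣ) :
    mixedMoment q (Fin.snoc (Fin.snoc (Fin.snoc ε (-1) : Fin (m + 1) → ℤˣ) 1 : Fin (m + 2) → ℤˣ) 1 :
      Fin (m + 3) → ℤˣ) (fun _ => f)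
      = (1 + ((q : ℝ) : ℂ)) * mixedMoment q (Fin.snoc ε 1 : Fin (m + 1) → ℤˣ) (fun _ => f) := by
  simp only [mixedMoment_const, signWord_snoc, signedOp_one_powerVector,
    signedOp_neg_one_powerVector_succ q hf]
  simp [loweringFactor]

end PowerVectors

/-! ### Balanced sign sequences and their last `-1` -/

section SignSequences

theorem sum_Ici_last {m : ℕ} (u : Fin (m + 1) → ℤ) :
    ∑ h ∈ Finset.Ici (Fin.last m), u h = u (Fin.last m) := by
  have : Finset.Ici (Fin.last m) = {Fin.last m} := by
    ext i
    simp [Fin.last_le_iff]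
  rw [this, Finset.sum_singleton]

theorem sum_Ici_castSucc {m : ℕ} (u : Fin (m + 1) → ℤ) (p : Fin m) :
    ∑ h ∈ Finset.Ici p.castSucc, u h = ∑ h ∈ Finset.Ici p, u h.castSucc + u (Fin.last m) := by
  -- Tail sums become full sums with an indicator, from which the last term can be split off.
  have h₁ : ∀ (k : ℕ) (p : Fin k) (w : Fin k → ℤ),
      ∑ h ∈ Finset.Ici p, w h = ∑ h, if p ≤ h then w h else 0 := by
    intro k p w
    rw [← Finset.sum_filter]
    congr 1
    ext i
    simp
  rw [h₁, h₁, Fin.sum_univ_castSucc]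
  simp [Fin.le_last]

/-- The total sum vanishes and the tail sums are nonnegative. -/
def IsBalanced {m : ℕ} (ε : Fin m → ℤˣ) : Prop :=
  ∑ h, (ε h : ℤ) = 0 ∧ ∀ p, 0 ≤ ∑ h ∈ Finset.Ici p, (ε h : ℤ)

theorem mem_signSeq {n : ℕ} {ε : Fin (2 * n) → ℤˣ} : ε ∈ signSeq n ↔ IsBalanced ε := by
  simp [signSeq, IsBalanced]

/-- The appended block has sum `0`, so the old tail sums are unchanged, and the new ones are `0` and
`1`. -/
theorem isBalanced_snoc_neg_one_one {m : ℕ} (ε : Fin m → ℤˣ) :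
    IsBalanced (Fin.snoc (Fin.snoc ε (-1) : Fin (m + 1) → ℤˣ) 1 : Fin (m + 2) → ℤˣ)
      ↔ IsBalanced ε := by
  simp [IsBalanced, Fin.forall_fin_succ', Fin.sum_univ_castSucc, sum_Ici_last, sum_Ici_castSucc]

/-- The endings `-1, 1, 1` and `1` both have sum `1`, and all tail sums starting inside them are
positive. -/
theorem isBalanced_snoc_neg_one_one_one {m : ℕ} (ε : Fin m → ℤˣ) :
    IsBalanced (Fin.snoc (Fin.snoc (Fin.snoc ε (-1) : Fin (m + 1) → ℤˣ) 1 : Fin (m + 2) → ℤˣ) 1 :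
      Fin (m + 3) → ℤˣ) ↔ IsBalanced (Fin.snoc ε 1 : Fin (m + 1) → ℤˣ) := by
  simp [IsBalanced, Fin.forall_fin_succ', Fin.sum_univ_castSucc, sum_Ici_last, sum_Ici_castSucc]

theorem IsBalanced.apply_last {m : ℕ} {ε : Fin (m + 1) → ℤˣ} (h : IsBalanced ε) :
    ε (Fin.last m) = 1 := by
  have h' := h.2 (Fin.last m)
  rw [sum_Ici_last (fun i => (ε i : ℤ))] at h'
  rcases Int.units_eq_one_or (ε (Fin.last m)) with h₁ | h₁
  · exact h₁
  · simp [h₁] at h'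

theorem mem_signSeqLast {n k : ℕ} {ε : Fin (2 * n) → ℤˣ} :
    ε ∈ signSeqLast n k ↔ IsBalanced ε ∧
      ∃ j : Fin (2 * n), (j : ℕ) + 1 + k = 2 * n ∧ ε j = -1 ∧ ∀ i, j < i → ε i = 1 := by
  simp [signSeqLast, mem_signSeq]

theorem mem_signSeqLast_one {n : ℕ} {ε : Fin (2 * n + 2) → ℤˣ} :
    ε ∈ signSeqLast (n + 1) 1 ↔
      ∃ ε' ∈ signSeq n, (Fin.snoc (Fin.snoc ε' (-1) : Fin (2 * n + 1) → ℤˣ) 1) = ε := by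
  rw [mem_signSeqLast]
  constructor
  · rintro ⟨hb, j, hj, hj₁, -⟩
    -- Indices start at `0`, so the last `-1` has index `2 * n`, the second to last.
    have hj' : j = (Fin.last (2 * n)).castSucc := by ext; simp; omega
    have hε : (Fin.snoc (Fin.snoc (Fin.init (Fin.init ε)) (-1) : Fin (2 * n + 1) → ℤˣ) 1) = ε := by
      rw [← hj₁, hj', ← IsBalanced.apply_last hb]
      change Fin.snoc (Fin.snoc (Fin.init (Fin.init ε)) (Fin.init ε (Fin.last _))) _ = ε
      rw [Fin.snoc_init_self, Fin.snoc_init_self]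
    refine ⟨Fin.init (Fin.init ε), ?_, hε⟩
    rw [mem_signSeq, ← isBalanced_snoc_neg_one_one, hε]
    exact hb
  · rintro ⟨ε', h, rfl⟩
    refine ⟨(isBalanced_snoc_neg_one_one ε').2 (mem_signSeq.1 h), (Fin.last (2 * n)).castSucc,
      by simp; omega, by simp, fun i hi => ?_⟩
    have : i = Fin.last (2 * n + 1) := by
      ext
      have := i.2
      simp [Fin.lt_def] at hi ⊢
      omega
    rw [this, Fin.snoc_last]

theorem mem_signSeqLast_two {m : ℕ} {ε : Fin (2 * m + 4) → ℤˣ} :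
    ε ∈ signSeqLast (m + 2) 2 ↔
      ∃ ε' : Fin (2 * m + 1) → ℤˣ, IsBalanced (Fin.snoc ε' 1 : Fin (2 * m + 2) → ℤˣ) ∧
        (Fin.snoc (Fin.snoc (Fin.snoc ε' (-1) : Fin (2 * m + 2) → ℤˣ) 1 :
          Fin (2 * m + 3) → ℤˣ) 1) = ε := by
  rw [mem_signSeqLast]
  constructor
  · rintro ⟨hb, j, hj, hj₁, hj₂⟩
    -- Here the index is `2 * m + 1`, the third from the end.
    have hj' : j = (Fin.last (2 * m + 1)).castSucc.castSucc := by ext; simp; omega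
    have h₂ : ε (Fin.last (2 * m + 2)).castSucc = 1 := hj₂ _ (by rw [hj']; simp [Fin.lt_def])
    have hε : (Fin.snoc (Fin.snoc (Fin.snoc (Fin.init (Fin.init (Fin.init ε))) (-1) :
        Fin (2 * m + 2) → ℤˣ) 1 : Fin (2 * m + 3) → ℤˣ) 1) = ε := by
      conv_lhs => rw [← hj₁, hj']
      refine Eq.trans ?_ (Fin.snoc_init_self ε)
      congr 1
      · refine Eq.trans ?_ (Fin.snoc_init_self (Fin.init ε))
        congr 1
        · exact Fin.snoc_init_self (Fin.init (Fin.init ε))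
        · exact h₂.symm
      · exact (IsBalanced.apply_last hb).symm
    refine ⟨Fin.init (Fin.init (Fin.init ε)), ?_, hε⟩
    rw [← isBalanced_snoc_neg_one_one_one, hε]
    exact hb
  · rintro ⟨ε', h, rfl⟩
    refine ⟨(isBalanced_snoc_neg_one_one_one ε').2 h, (Fin.last (2 * m + 1)).castSucc.castSucc,
      by simp; omega, by simp, fun i hi => ?_⟩
    rcases Fin.eq_castSucc_or_eq_last (n := 2 * m + 3) i with ⟨i, rfl⟩ | rfl
    · have : i = Fin.last (2 * m + 2) := by
        ext
        have := i.2
        simp [Fin.lt_def] at hi ⊢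
        omega
      rw [this, Fin.snoc_castSucc, Fin.snoc_last]
    · rw [Fin.snoc_last]

/-- A final run of `k` ones forces the total sum to be at least `k - (2n - k)`, and the total is
`0`. -/
theorem IsBalanced.last_run_le {n k : ℕ} {ε : Fin (2 * n) → ℤˣ} (h : IsBalanced ε)
    {j : Fin (2 * n)} (hj : (j : ℕ) + 1 + k = 2 * n) (hj₂ : ∀ i, j < i → ε i = 1) : k ≤ n := by
  have hsum : ∑ i, (if j < i then (1 : ℤ) else -1) ≤ ∑ i, (ε i : ℤ) := by
    refine Finset.sum_le_sum fun i _ => ?_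
    split_ifs with hi
    · simp [hj₂ i hi]
    · rcases Int.units_eq_one_or (ε i) with h₁ | h₁ <;> simp [h₁]
  have hcount : ∑ i, (if j < i then (1 : ℤ) else -1) = 2 * k - 2 * n := by
    have : ∀ i, (if j < i then (1 : ℤ) else -1) = 2 * (if j < i then 1 else 0) - 1 := by
      intro i
      split_ifs <;> norm_num
    simp only [this, Finset.sum_sub_distrib, ← Finset.mul_sum, Finset.sum_boole]
    have hc : (Finset.univ.filter fun i => j < i) = Finset.Ioi j := by ext; simp
    rw [hc, Fin.card_Ioi]
    simp
    omega
  rw [hcount, h.1] at hsum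
  omega

/-- A sum of `2n > 0` ones is not `0`, so some `-1` occurs. The last one is not at the end, whence
`k ≥ 1`, and `k ≤ n` by `IsBalanced.last_run_le`. For `n = 0` the empty sequence would be missed. -/
theorem signSeq_eq_biUnion {n : ℕ} (hn : 1 ≤ n) :
    signSeq n = (Finset.Icc 1 n).biUnion (signSeqLast n) := by
  ext ε
  simp only [Finset.mem_biUnion, Finset.mem_Icc, mem_signSeqLast, mem_signSeq]
  constructor
  · intro h
    have hne : (Finset.univ.filter fun i => ε i = -1).Nonempty := by
      by_contra hemp
      rw [Finset.not_nonempty_iff_eq_empty, Finset.filter_eq_empty_iff] at hemp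
      have h1 : ∀ i, ε i = 1 := fun i =>
        (Int.units_eq_one_or (ε i)).resolve_right (hemp (Finset.mem_univ i))
      have h0 := h.1
      simp [h1] at h0
      omega
    obtain ⟨j, hj, hmax⟩ := Finset.exists_max_image _ id hne
    simp only [Finset.mem_filter, Finset.mem_univ, true_and, id] at hj hmax
    have hj₂ : ∀ i, j < i → ε i = 1 := fun i hi =>
      (Int.units_eq_one_or (ε i)).resolve_right fun hi' => (hmax i hi').not_gt hi
    have hjn : (j : ℕ) + 1 + (2 * n - 1 - j) = 2 * n := by omega
    refine ⟨2 * n - 1 - j, ⟨?_, h.last_run_le hjn hj₂⟩, h, j, hjn, hj, hj₂⟩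
    by_contra hk
    obtain ⟨m, rfl⟩ : ∃ m, n = m + 1 := ⟨n - 1, by omega⟩
    have hlast : j = Fin.last (2 * m + 1) := by
      ext
      simp
      omega
    have h1 : ε (Fin.last (2 * m + 1)) = 1 := IsBalanced.apply_last (m := 2 * m + 1) h
    rw [hlast, h1] at hj
    exact absurd hj (by decide)
  · rintro ⟨k, -, h, -⟩
    exact h

theorem pairwiseDisjoint_signSeqLast (n : ℕ) (s : Set ℕ) :
    s.PairwiseDisjoint (signSeqLast n) := by
  intro k _ l _ hkl
  refine Finset.disjoint_left.2 fun ε hk hl => hkl ?_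
  obtain ⟨-, i, hi, hi₁, hi₂⟩ := mem_signSeqLast.1 hk
  obtain ⟨-, j, hj, hj₁, hj₂⟩ := mem_signSeqLast.1 hl
  rcases lt_trichotomy i j with h | h | h
  · exact absurd ((hi₂ j h).symm.trans hj₁) (by decide)
  · subst h
    omega
  · exact absurd ((hj₂ i h).symm.trans hi₁) (by decide)

end SignSequences

/-! ### Recursions and cardinalities -/

section Counting

variable {H : Type*} [NormedAddCommGroup H] [InnerProductSpace ℂ H]

theorem totalCount_eq_sum (q : Set.Icc (-1 : ℝ) 1) (f : H) {n : ℕ} (hn : 1 ≤ n) :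
    totalCount q f n = ∑ ε ∈ signSeq n, mixedMoment q ε (fun _ => f) := by
  rw [signSeq_eq_biUnion hn, Finset.sum_biUnion (pairwiseDisjoint_signSeqLast n _)]
  rfl

theorem pairCount_succ_one (q : Set.Icc (-1 : ℝ) 1) {f : H} (hf : ‖f‖ = 1) {n : ℕ} (hn : 1 ≤ n) :
    pairCount q f (n + 1) 1 = totalCount q f n := by
  rw [totalCount_eq_sum q f hn, pairCount]
  symm
  refine Finset.sum_bij
    (fun ε' _ => (Fin.snoc (Fin.snoc ε' (-1) : Fin (2 * n + 1) → ℤˣ) 1 : Fin (2 * n + 2) → ℤˣ))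
    (fun ε' h => mem_signSeqLast_one.2 ⟨ε', h, rfl⟩) ?_ ?_ ?_
  · intro a _ b _ hab
    exact (Fin.snoc_inj.1 (Fin.snoc_inj.1 hab).1).1
  · intro ε hε
    obtain ⟨ε', h, h'⟩ := mem_signSeqLast_one.1 hε
    exact ⟨ε', h, h'⟩
  · intro ε' _
    exact (mixedMoment_snoc_neg_one_one q hf ε').symm

theorem pairCount_succ_two (q : Set.Icc (-1 : ℝ) 1) {f : H} (hf : ‖f‖ = 1) {n : ℕ} (hn : 1 ≤ n) :
    pairCount q f (n + 1) 2 = (1 + ((q : ℝ) : ℂ)) * totalCount q f n := by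
  rw [totalCount_eq_sum q f hn, pairCount, Finset.mul_sum]
  -- For `n ≥ 1` a balanced sequence has a last letter, necessarily `1`; the bijection replaces it
  -- by `-1, 1, 1`.
  obtain ⟨m, rfl⟩ : ∃ m, n = m + 1 := ⟨n - 1, by omega⟩
  have hinit : ∀ ε ∈ signSeq (m + 1),
      (Fin.snoc (Fin.init (n := 2 * m + 1) ε) 1 : Fin (2 * m + 2) → ℤˣ) = ε := by
    intro ε hε
    have h1 : ε (Fin.last (2 * m + 1)) = 1 :=
      IsBalanced.apply_last (m := 2 * m + 1) (mem_signSeq.1 hε)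
    rw [← h1]
    exact Fin.snoc_init_self (n := 2 * m + 1) ε
  symm
  refine Finset.sum_bij
    (fun ε _ => (Fin.snoc (Fin.snoc (Fin.snoc (Fin.init (n := 2 * m + 1) ε) (-1) :
      Fin (2 * m + 2) → ℤˣ) 1 : Fin (2 * m + 3) → ℤˣ) 1 : Fin (2 * m + 4) → ℤˣ)) ?_ ?_ ?_ ?_
  · intro ε hε
    refine mem_signSeqLast_two.2 ⟨_, ?_, rfl⟩
    rw [hinit ε hε]
    exact mem_signSeq.1 hε
  · intro a ha b hb hab
    rw [← hinit a ha, ← hinit b hb,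
      (Fin.snoc_inj.1 (Fin.snoc_inj.1 (Fin.snoc_inj.1 hab).1).1).1]
  · intro ε hε
    obtain ⟨ε', h, h'⟩ := mem_signSeqLast_two.1 hε
    refine ⟨(Fin.snoc ε' 1 : Fin (2 * m + 2) → ℤˣ), mem_signSeq.2 h, ?_⟩
    rw [← h', Fin.init_snoc (n := 2 * m + 1)]
  · intro ε hε
    have h := mixedMoment_snoc_neg_one_one_one q hf (Fin.init (n := 2 * m + 1) ε)
    rw [hinit ε hε] at h
    exact h.symm

/-- Every position is an endpoint of some pair, and being a left or right endpoint fixes its sign.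
-/
theorem IsPairPartitionOf.sign_unique {n : ℕ} {ε ε' : Fin (2 * n) → ℤˣ}
    {θ : Finset (Fin (2 * n) × Fin (2 * n))} (h : IsPairPartitionOf ε θ)
    (h' : IsPairPartitionOf ε' θ) : ε = ε' := by
  funext i
  obtain ⟨p, hp, rfl | rfl⟩ := h.1.2.2 i
  · rw [(h.2 p hp).1, (h'.2 p hp).1]
  · rw [(h.2 p hp).2, (h'.2 p hp).2]

/-- With all vectors equal to `f` each product is `1`, so the moment of `ε` is the cardinality of `S
ε`; these sets are disjoint by `IsPairPartitionOf.sign_unique`. A general `T` covers both the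
classes with fixed `k` and the whole of `signSeq n`. -/
theorem RepresentsMoments.card_biUnion {q : Set.Icc (-1 : ℝ) 1} {n : ℕ}
    {S : (Fin (2 * n) → ℤˣ) → Finset (Finset (Fin (2 * n) × Fin (2 * n)))}
    (hS : RepresentsMoments q H S) {f : H} (hf : ‖f‖ = 1) {T : Finset (Fin (2 * n) → ℤˣ)}
    (hT : T ⊆ signSeq n) :
    (((T.biUnion S).card : ℕ) : ℂ) = ∑ ε ∈ T, mixedMoment q ε (fun _ => f) := by
  rw [Finset.card_biUnion]
  · rw [Nat.cast_sum]
    refine Finset.sum_congr rfl fun ε hε => ?_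
    rw [(hS ε (hT hε)).2]
    simp [inner_self_eq_norm_sq_to_K, hf]
  · intro ε hε ε' hε' hne
    exact Finset.disjoint_left.2 fun θ hθ hθ' =>
      hne (((hS ε (hT hε)).1 θ hθ).sign_unique ((hS ε' (hT hε')).1 θ hθ'))

end Counting

end Q2Fock

theorem proposition4p3 {H : Type*} [NormedAddCommGroup H] [InnerProductSpace ℂ H] [CompleteSpace H]
    (q : Set.Icc (-1 : ℝ) 1) (f : H) (hf : ‖f‖ = 1) :
    -- the recursions
    (∀ n : ℕ, 1 ≤ n →
      Q2Fock.pairCount q f (n + 1) 1 = Q2Fock.totalCount q f n ∧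
      Q2Fock.pairCount q f (n + 1) 2 = (1 + ((q : ℝ) : ℂ)) * Q2Fock.totalCount q f n) ∧
    -- the numbers do not depend on the unit vector
    (∀ g : H, ‖g‖ = 1 → ∀ n k : ℕ, 1 ≤ k → k ≤ n →
      Q2Fock.pairCount q g n k = Q2Fock.pairCount q f n k) ∧
    -- they are cardinalities whenever sets of pair partitions compute the mixed moments
    (∀ n : ℕ, 1 ≤ n →
      ∀ S : (Fin (2 * n) → ℤˣ) → Finset (Finset (Fin (2 * n) × Fin (2 * n))),
        Q2Fock.RepresentsMoments q H S →
          (∀ k : ℕ, 1 ≤ k → k ≤ n →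
            ((((Q2Fock.signSeqLast n k).biUnion S).card : ℕ) : ℂ) = Q2Fock.pairCount q f n k) ∧
          ((((Q2Fock.signSeq n).biUnion S).card : ℕ) : ℂ) = Q2Fock.totalCount q f n) := by
  refine ⟨fun n hn => ⟨Q2Fock.pairCount_succ_one q hf hn, Q2Fock.pairCount_succ_two q hf hn⟩,
    fun g hg n k _ _ => Finset.sum_congr rfl fun ε _ => Q2Fock.mixedMoment_const_eq q hf hg ε,
    fun n hn S hS => ⟨fun k _ _ => hS.card_biUnion hf (Finset.filter_subset _ _), ?_⟩⟩
  rw [Q2Fock.totalCount_eq_sum q f hn]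
  exact hS.card_biUnion hf (Finset.Subset.refl _)
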